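/- **Valued WSP.** An instance consists of a set $S$ of $k$ steps with an acyclic directed graph on $S$, a set $U$ of $n$ users, an authorisation policy $A\subseteq S\times U$, and $m$ constraints $c=(T_c,\Theta_c)$, where $T_c\subseteq S$ and $\Theta_c$ is a family of functions $T_c\to U$; a complete plan $\pi:S\to U$ satisfies $c$ if $\pi|_{T_c}\in\Theta_c$. For each constraint $c$ there is a weight function $w_c$, which maps each complete plan $\pi$ to an integer that is $0$ if $\pi$ satisfies $c$ and positive otherwise. There is also a set-authorisation function $\omega:2^S\times U\to\mathbb{Z}$ with $\omega(T,u)=0$ if $(s,u)\in A$ for all $s\in T$ and $\omega(T,u)>0$ otherwise. The task is to find a complete plan $\pi:S\to U$ that minimises $$w(\pi)=\sum_{c}w_c(\pi)+\sum_{u\in U}\omega(\pi^{-1}(u),u).$$ A weighted constraint $c$ is *user-independent* if $w_c(\theta\circ\pi)=w_c(\pi)$ for every complete plan $\pi$ and every permutation $\theta$ of $U$. **Computational model.** Time is counted on a random access machine with integer registers and arrays, whose arithmetic operations are addition and subtraction, at unit cost. The program receives $k,n,m$ and can ask for any value $w_c(\pi)$ or $\omega(T,u)$. Each such value is computed in time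 bounded by a polynomial in $k+n+m$ that is fixed in advance (in addition, a query is charged $k$ units for passing $\pi$ or $T$). **Theorem.** Valued WSP in which all weighted constraints are user-independent can be solved in time $2^{k\log_2 k}(k+n+m)^{O(1)}$. More precisely, there is a program such that, for every polynomial bound on the time of a single weight computation, there are constants $a,c$ such that the program, on every instance that has user-independent weighted constraints and at least one complete plan, halts after at most $a\cdot 2^{k\log_2 k}(k+n+m+1)^{c}$ steps with a complete plan of minimum weight (where $k\log_2k=0$ for $k=0$). Thus Valued WSP with user-independent constraints is fixed-parameter tractable when parameterised by the number $k$ of steps: it is solved in time $f(k)\,(k+n+m+1)^{O(1)}$ for a computable function $f$. -/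

import Mathlib

namespace ValuedWSP

/-! ## The problem

The steps are `Fin k`, the users are `Fin n`, and the constraints are indexed by `Fin m`. -/

/-- A complete plan assigns a user to every step. -/
abbrev Plan (k n : ℕ) : Type := Fin k → Fin n

/-- A workflow constraint: a scope and a family of functions from the scope to the users. -/
structure Constraint (k n : ℕ) where
  scope : Finset (Fin k)
  allowed : Set (scope → Fin n)

/-- A complete plan satisfies a constraint if its restriction to the scope is in the family. -/
def Constraint.SatisfiedBy {k n : ℕ} (c : Constraint k n) (π : Plan k n) : Prop :=
  (fun s : c.scope => π s.1) ∈ c.allowed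

/-- A constrained workflow authorisation schema: an acyclic directed graph on the steps, an
authorisation policy, and `m` constraints. -/
structure Schema (k n m : ℕ) where
  edge : Fin k → Fin k → Prop
  acyclic : ∀ s, ¬ Relation.TransGen edge s s
  auth : Set (Fin k × Fin n)
  con : Fin m → Constraint k n

/-- An instance of the valued workflow satisfiability problem: a schema with a weight function
for each constraint and a weighted set-authorisation function. -/
structure ValuedInstance (k n m : ℕ) extends Schema k n m where
  conWeight : Fin m → Plan k n → ℤ
  conWeight_eq_zero : ∀ c π, (con c).SatisfiedBy π → conWeight c π = 0
  conWeight_pos : ∀ c π, ¬ (con c).SatisfiedBy π → 0 < conWeight c π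
  setWeight : Finset (Fin k) → Fin n → ℤ
  setWeight_eq_zero : ∀ T u, (∀ s ∈ T, (s, u) ∈ auth) → setWeight T u = 0
  setWeight_pos : ∀ T u, ¬ (∀ s ∈ T, (s, u) ∈ auth) → 0 < setWeight T u

namespace ValuedInstance

variable {k n m : ℕ}

/-- The constraint weight of a plan. -/
def constraintWeight (I : ValuedInstance k n m) (π : Plan k n) : ℤ :=
  ∑ c : Fin m, I.conWeight c π

/-- The authorisation weight of a plan: each user contributes the weight of the set of all steps
that are assigned to this user. -/
def authorisationWeight (I : ValuedInstance k n m) (π : Plan k n) : ℤ :=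
  ∑ u : Fin n, I.setWeight (Finset.univ.filter fun s => π s = u) u

/-- The total weight of a plan. -/
def weight (I : ValuedInstance k n m) (π : Plan k n) : ℤ :=
  I.constraintWeight π + I.authorisationWeight π

/-- A complete plan of minimum weight. -/
def IsOptimal (I : ValuedInstance k n m) (π : Plan k n) : Prop :=
  ∀ π' : Plan k n, I.weight π ≤ I.weight π'

/-- Every weighted constraint is user-independent. -/
def UserIndependent (I : ValuedInstance k n m) : Prop :=
  ∀ (c : Fin m) (θ : Equiv.Perm (Fin n)) (π : Plan k n), I.conWeight c (θ ∘ π) = I.conWeight c π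

end ValuedInstance

/-! ## The machine model

A random access machine with structured control flow. Its memory consists of integer registers
and of integer arrays that are addressed by computed indices. The only arithmetic operations are
addition and subtraction, and every elementary operation costs one time unit. The weights of the
instance are available through two query instructions. -/

/-- The memory: registers, and arrays with computed indices. -/
structure Memory where
  reg : ℕ → ℤ
  arr : ℕ → ℤ → ℤ

/-- Overwrite one register. -/
def Memory.setReg (σ : Memory) (x : ℕ) (v : ℤ) : Memory :=
  { σ with reg := Function.update σ.reg x v }

/-- Overwrite one array cell. -/
def Memory.setArr (σ : Memory) (a : ℕ) (i v : ℤ) : Memory :=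
  { σ with arr := Function.update σ.arr a (Function.update (σ.arr a) i v) }

/-- Arithmetic expressions. -/
inductive Expr where
  | const (z : ℤ)
  | reg (x : ℕ)
  | read (a : ℕ) (i : Expr)
  | add (e f : Expr)
  | sub (e f : Expr)

/-- The value of an expression. -/
def Expr.eval (σ : Memory) : Expr → ℤ
  | .const z => z
  | .reg x => σ.reg x
  | .read a i => σ.arr a (i.eval σ)
  | .add e f => e.eval σ + f.eval σ
  | .sub e f => e.eval σ - f.eval σ

/-- The time for evaluating an expression: the number of its operations. -/
def Expr.cost : Expr → ℕ
  | .const _ => 1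
  | .reg _ => 1
  | .read _ i => i.cost + 1
  | .add e f => e.cost + f.cost + 1
  | .sub e f => e.cost + f.cost + 1

/-- Tests. -/
inductive Test where
  | le (e f : Expr)
  | eq (e f : Expr)
  | not (b : Test)
  | and (b c : Test)

/-- The truth of a test. -/
def Test.Holds (σ : Memory) : Test → Prop
  | .le e f => e.eval σ ≤ f.eval σ
  | .eq e f => e.eval σ = f.eval σ
  | .not b => ¬ b.Holds σ
  | .and b c => b.Holds σ ∧ c.Holds σ

/-- The time for evaluating a test. -/
def Test.cost : Test → ℕ
  | .le e f => e.cost + f.cost + 1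
  | .eq e f => e.cost + f.cost + 1
  | .not b => b.cost + 1
  | .and b c => b.cost + c.cost + 1

/-- Programs. `queryCon x e a` puts into register `x` the weight that the constraint with number
`e` gives to the plan stored in array `a`; `querySet x e a` puts into register `x` the weight of
assigning to the user with number `e` the set of steps whose characteristic vector is stored in
array `a`. -/
inductive Program where
  | skip
  | assign (x : ℕ) (e : Expr)
  | write (a : ℕ) (i e : Expr)
  | seq (p q : Program)
  | cond (b : Test) (p q : Program)
  | loop (b : Test) (p : Program)
  | queryCon (x : ℕ) (e : Expr) (a : ℕ)
  | querySet (x : ℕ) (e : Expr) (a : ℕ)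

/-- `Runs I τ P σ σ' t`: on the instance `I`, when the computation of a single weight takes time
`τ`, the program `P`, started in memory `σ`, halts in memory `σ'` after time exactly `t`. A query
whose argument is not a constraint and a plan, or not a user, has no run. -/
inductive Runs {k n m : ℕ} (I : ValuedInstance k n m) (τ : ℕ) :
    Program → Memory → Memory → ℕ → Prop
  | skip (σ : Memory) : Runs I τ .skip σ σ 1
  | assign (σ : Memory) (x : ℕ) (e : Expr) :
      Runs I τ (.assign x e) σ (σ.setReg x (e.eval σ)) (e.cost + 1)
  | write (σ : Memory) (a : ℕ) (i e : Expr) :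
      Runs I τ (.write a i e) σ (σ.setArr a (i.eval σ) (e.eval σ)) (i.cost + e.cost + 1)
  | seq {p q : Program} {σ₁ σ₂ σ₃ : Memory} {s t : ℕ} :
      Runs I τ p σ₁ σ₂ s → Runs I τ q σ₂ σ₃ t → Runs I τ (.seq p q) σ₁ σ₃ (s + t)
  | condTrue {b : Test} {p q : Program} {σ σ' : Memory} {t : ℕ} :
      b.Holds σ → Runs I τ p σ σ' t → Runs I τ (.cond b p q) σ σ' (b.cost + 1 + t)
  | condFalse {b : Test} {p q : Program} {σ σ' : Memory} {t : ℕ} :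
      ¬ b.Holds σ → Runs I τ q σ σ' t → Runs I τ (.cond b p q) σ σ' (b.cost + 1 + t)
  | loopTrue {b : Test} {p : Program} {σ₁ σ₂ σ₃ : Memory} {s t : ℕ} :
      b.Holds σ₁ → Runs I τ p σ₁ σ₂ s → Runs I τ (.loop b p) σ₂ σ₃ t →
        Runs I τ (.loop b p) σ₁ σ₃ (b.cost + 1 + s + t)
  | loopFalse {b : Test} {p : Program} {σ : Memory} :
      ¬ b.Holds σ → Runs I τ (.loop b p) σ σ (b.cost + 1)
  | queryCon (σ : Memory) (x : ℕ) (e : Expr) (a : ℕ) (c : Fin m) (π : Plan k n) :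
      e.eval σ = ((c : ℕ) : ℤ) → (∀ s : Fin k, σ.arr a ((s : ℕ) : ℤ) = ((π s : ℕ) : ℤ)) →
        Runs I τ (.queryCon x e a) σ (σ.setReg x (I.conWeight c π)) (e.cost + 1 + k + τ)
  | querySet (σ : Memory) (x : ℕ) (e : Expr) (a : ℕ) (u : Fin n) (T : Finset (Fin k)) :
      e.eval σ = ((u : ℕ) : ℤ) → (∀ s : Fin k, s ∈ T ↔ σ.arr a ((s : ℕ) : ℤ) ≠ 0) →
        Runs I τ (.querySet x e a) σ (σ.setReg x (I.setWeight T u)) (e.cost + 1 + k + τ)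

/-- The initial memory: `k`, `n`, `m` in the first three registers and zeros elsewhere. -/
def initialMemory (k n m : ℕ) : Memory where
  reg x := if x = 0 then k else if x = 1 then n else if x = 2 then m else 0
  arr _ _ := 0

/-- The program halts after time `t` on the instance `I`, with a complete plan of minimum weight
in the first `k` cells of array `0`. -/
def SolvesInTime {k n m : ℕ} (P : Program) (I : ValuedInstance k n m) (τ t : ℕ) : Prop :=
  ∃ σ : Memory, Runs I τ P (initialMemory k n m) σ t ∧
    ∃ π : Plan k n, (∀ s : Fin k, σ.arr 0 ((s : ℕ) : ℤ) = ((π s : ℕ) : ℤ)) ∧ I.IsOptimal π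

/-- Fixed-parameter tractability, with the number `k` of steps as the parameter, of the valued
workflow satisfiability problem on the instances in `X` that have a complete plan: some program
solves it in time `f(k) * (k + n + m + 1) ^ c` with `f` computable, whenever the time `τ` for
computing a single weight is polynomially bounded in `k + n + m`. -/
def IsFPT (X : ∀ k n m : ℕ, Set (ValuedInstance k n m)) : Prop :=
  ∃ P : Program, ∀ b d : ℕ, ∃ (f : ℕ → ℕ) (c : ℕ), Computable f ∧
    ∀ (k n m : ℕ) (I : ValuedInstance k n m), I ∈ X k n m → Nonempty (Plan k n) →
      ∀ τ : ℕ, τ ≤ b * (k + n + m + 1) ^ d →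
        ∃ t : ℕ, SolvesInTime P I τ t ∧ t ≤ f k * (k + n + m + 1) ^ c

end ValuedWSP

/-! Two plans that induce the same partition of the steps into fibres differ by a permutation of the
users, so by user-independence they have the same constraint weight. Once the blocks are fixed, what
remains is to assign them to distinct users at minimum cost. This is done without a matching
algorithm, by serial dictatorships: the blocks are ordered, and each in turn takes a cheapest user
that is still free.

For a suitable order this loses nothing. In an optimal plan, let every open block point to its
cheapest free user, and every user to the block it holds. This has a cycle, as in the top trading
cycles of house allocation. Rotating the users along it gives each block on it its favourite, so the
weight does not increase and the plan stays optimal (`exists_perm_trade`). One block of the cycle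
becomes the next dictator, its user is frozen, and the argument is repeated with the other blocks
(`exists_dictator_isOptimal_of_prefix`).

Partition and order are encoded together by a map from the steps to `k` block numbers. One of these
`k ^ k` maps yields an optimal plan. Every other map still yields some complete plan, even with
empty blocks or too few users, so the best candidate is optimal. The program counts through the maps
in base `k` and spends polynomial time on each; `k ^ k` equals `2 ^ (k log₂ k)`. Its correctness and
running time are derived together, from the rules for `Halts` and in particular
`Halts.countingLoop`. -/

namespace ValuedWSP

/-! ## Serial dictatorships -/

/-- Scan the users `0, …, j - 1` outside `used` for the first one of minimum weight. -/
def cheapest {n : ℕ} (used : Finset (Fin n)) (w : Fin n → ℤ) : ℕ → Option (Fin n)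
  | 0 => none
  | j + 1 =>
    if h : j < n then
      if (⟨j, h⟩ : Fin n) ∈ used then cheapest used w j
      else match cheapest used w j with
        | none => some ⟨j, h⟩
        | some c => if w c ≤ w ⟨j, h⟩ then some c else some ⟨j, h⟩
    else cheapest used w j

theorem cheapest_spec {n : ℕ} (used : Finset (Fin n)) (w : Fin n → ℤ) (j : ℕ) :
    (cheapest used w j = none → ∀ u : Fin n, (u : ℕ) < j → u ∈ used) ∧
      ∀ c, cheapest used w j = some c →
        c ∉ used ∧ ∀ u : Fin n, (u : ℕ) < j → u ∉ used → w c ≤ w u := by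
  induction j with
  | zero => simp [cheapest]
  | succ j ih =>
    obtain ⟨ih₁, ih₂⟩ := ih
    have split : ∀ u : Fin n, (u : ℕ) < j + 1 → (u : ℕ) < j ∨ ∃ h : j < n, u = ⟨j, h⟩ := by
      intro u hu
      rcases Nat.lt_succ_iff_lt_or_eq.1 hu with h | h
      · exact .inl h
      · exact .inr ⟨h ▸ u.2, Fin.ext h⟩
    rw [cheapest]
    split_ifs with h hu
    · refine ⟨fun e u hj => ?_, fun c e => ⟨(ih₂ c e).1, fun u hj hn => ?_⟩⟩
      · rcases split u hj with hj | ⟨_, rfl⟩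
        exacts [ih₁ e u hj, hu]
      · rcases split u hj with hj | ⟨_, rfl⟩
        exacts [(ih₂ c e).2 u hj hn, absurd hu hn]
    · cases hc : cheapest used w j with
      | none =>
        refine ⟨by simp, fun c e => ?_⟩
        obtain rfl : (⟨j, h⟩ : Fin n) = c := by simpa using e
        refine ⟨hu, fun u hj hn => ?_⟩
        rcases split u hj with hj | ⟨_, rfl⟩
        exacts [absurd (ih₁ hc u hj) hn, le_rfl]
      | some d =>
        obtain ⟨hd, hmin⟩ := ih₂ d hc
        refine ⟨by dsimp only; split_ifs <;> simp, fun c e => ?_⟩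
        dsimp only at e
        split_ifs at e with hle
        · obtain rfl : d = c := by simpa using e
          refine ⟨hd, fun u hj hn => ?_⟩
          rcases split u hj with hj | ⟨_, rfl⟩
          exacts [hmin u hj hn, hle]
        · obtain rfl : (⟨j, h⟩ : Fin n) = c := by simpa using e
          refine ⟨hu, fun u hj hn => ?_⟩
          rcases split u hj with hj | ⟨_, rfl⟩
          exacts [(not_le.1 hle).le.trans (hmin u hj hn), le_rfl]
    · refine ⟨fun e u hj => ?_, fun c e => ⟨(ih₂ c e).1, fun u hj hn => ?_⟩⟩
      · rcases split u hj with hj | ⟨h', -⟩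
        exacts [ih₁ e u hj, absurd h' h]
      · rcases split u hj with hj | ⟨h', -⟩
        exacts [(ih₂ c e).2 u hj hn, absurd h' h]

/-- A cheapest user outside `used`, or the user `0` if there is no user outside `used`. -/
def pick {n : ℕ} [NeZero n] (used : Finset (Fin n)) (w : Fin n → ℤ) : Fin n :=
  (cheapest used w n).getD 0

theorem pick_spec {n : ℕ} [NeZero n] {used : Finset (Fin n)} (w : Fin n → ℤ) {v : Fin n}
    (hv : v ∉ used) : pick used w ∉ used ∧ w (pick used w) ≤ w v := by
  obtain ⟨h₁, h₂⟩ := cheapest_spec used w n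
  unfold pick
  cases hc : cheapest used w n with
  | none => exact absurd (h₁ hc v v.2) hv
  | some c => exact ⟨(h₂ c hc).1, (h₂ c hc).2 v v.2 hv⟩

/-! ### Cycles of a self-map of a finite type -/

theorem exists_mem_periodicPts {α : Type*} [Finite α] [Nonempty α] (g : α → α) :
    ∃ x, x ∈ Function.periodicPts g := by
  obtain ⟨x⟩ := ‹Nonempty α›
  -- Pigeonhole on an orbit: two iterates of `x` coincide, and the earlier one has the difference of
  -- the exponents as a period.
  obtain ⟨i, j, hne, h⟩ := Finite.exists_ne_map_eq_of_infinite fun i : ℕ => g^[i] x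
  wlog hij : i < j generalizing i j
  · exact this j i hne.symm h.symm (by omega)
  refine ⟨g^[i] x, j - i, by omega, ?_⟩
  rw [Function.IsPeriodicPt, Function.IsFixedPt, ← Function.iterate_add_apply,
    Nat.sub_add_cancel hij.le]
  exact h.symm

/-- A self-map of a finite type agrees with a permutation on its periodic points. -/
theorem exists_perm_eq_on_periodicPts {α : Type*} [Finite α] (g : α → α) :
    ∃ θ : Equiv.Perm α, (∀ x ∈ Function.periodicPts g, θ x = g x) ∧
      ∀ x ∉ Function.periodicPts g, θ x = x := by
  classical
  have hb := Function.bijOn_periodicPts (f := g)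
  let h : α → α := fun x => if x ∈ Function.periodicPts g then g x else x
  have hinj : Function.Injective h := by
    intro x y hxy
    simp only [h] at hxy
    split_ifs at hxy with hx hy hy
    · exact hb.injOn hx hy hxy
    · exact absurd (hxy ▸ hb.mapsTo hx) hy
    · exact absurd (hxy ▸ hb.mapsTo hy) hx
    · exact hxy
  refine ⟨Equiv.ofBijective h (Finite.injective_iff_bijective.1 hinj), fun x hx => ?_,
    fun x hx => ?_⟩
  · simp [h, hx]
  · simp [h, hx]

/-! ### The exchange argument: optimal plans from serial dictatorships -/

namespace ValuedInstance

variable {k n m : ℕ} (I : ValuedInstance k n m)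

/-- The fibre of `π` over `u` is the fibre of `θ ∘ π` over `θ u`, so relabelling the users only
changes who pays for which block. -/
theorem weight_perm_comp (hI : I.UserIndependent) (θ : Equiv.Perm (Fin n)) (π : Plan k n) :
    I.weight (θ ∘ π) =
      I.constraintWeight π + ∑ u, I.setWeight (Finset.univ.filter fun s => π s = u) (θ u) := by
  unfold weight constraintWeight authorisationWeight
  congr 1
  · exact Finset.sum_congr rfl fun c _ => hI c θ π
  · rw [← Equiv.sum_comp θ]
    simp

theorem setWeight_empty (u : Fin n) : I.setWeight ∅ u = 0 :=
  I.setWeight_eq_zero _ _ (by simp)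

variable [NeZero n]

/-- The users that the serial dictatorship of the blocks of `f` has used before block `i`. -/
def usedBefore (f : Fin k → ℕ) : ℕ → Finset (Fin n)
  | 0 => ∅
  | i + 1 => insert
      (pick (usedBefore f i) (I.setWeight (Finset.univ.filter fun s => f s = i))) (usedBefore f i)

/-- The user that the serial dictatorship of the blocks of `f` assigns to block `i`. -/
def dictator (f : Fin k → ℕ) (i : ℕ) : Fin n :=
  pick (I.usedBefore f i) (I.setWeight (Finset.univ.filter fun s => f s = i))

theorem usedBefore_succ (f : Fin k → ℕ) (i : ℕ) :
    I.usedBefore f (i + 1) = insert (I.dictator f i) (I.usedBefore f i) := rfl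

theorem usedBefore_mono (f : Fin k → ℕ) : Monotone (I.usedBefore f) :=
  monotone_nat_of_le_succ fun i => by
    rw [usedBefore_succ]; exact Finset.subset_insert _ _

theorem dictator_mem_usedBefore (f : Fin k → ℕ) {i j : ℕ} (h : i < j) :
    I.dictator f i ∈ I.usedBefore f j :=
  I.usedBefore_mono f h (by rw [usedBefore_succ]; exact Finset.mem_insert_self _ _)

/-- The first `j` choices see only the first `j` blocks, so renumbering steps that are still open
does not disturb the choices already made. -/
theorem usedBefore_congr {f g : Fin k → ℕ} {j : ℕ}
    (h : ∀ i < j, ∀ s, f s = i ↔ g s = i) : I.usedBefore f j = I.usedBefore g j := by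
  induction j with
  | zero => rfl
  | succ j ih =>
    have := ih fun i hi => h i (by omega)
    simp only [usedBefore, this, h j (by omega)]

theorem dictator_congr {f g : Fin k → ℕ} {j i : ℕ} (hi : i < j)
    (h : ∀ i < j, ∀ s, f s = i ↔ g s = i) : I.dictator f i = I.dictator g i := by
  have hu : I.usedBefore f i = I.usedBefore g i :=
    I.usedBefore_congr fun i' hi' => h i' (by omega)
  simp only [dictator, hu, h i hi]

/-- One round of an exchange argument: some block of a set of unused users can receive its
cheapest unused user, and the weight does not increase. -/
theorem exists_perm_trade (hI : I.UserIndependent) (π : Plan k n) (used : Finset (Fin n))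
    {s₀ : Fin k} (h₀ : π s₀ ∉ used) :
    ∃ θ : Equiv.Perm (Fin n), I.weight (θ ∘ π) ≤ I.weight π ∧ (∀ u ∈ used, θ u = u) ∧
      ∃ s₁, π s₁ ∉ used ∧
        θ (π s₁) = pick used (I.setWeight (Finset.univ.filter fun s => π s = π s₁)) := by
  classical
  let R : Set (Fin n) := {v | v ∉ used ∧ ∃ s, π s = v}
  -- A user in `R` points to the cheapest unused user for its block. All others point to `π s₀`,
  -- which lies in `R`; hence `g` takes only unused values and each of its cycles meets `R`.
  let g : Fin n → Fin n := fun v =>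
    if v ∈ R then pick used (I.setWeight (Finset.univ.filter fun s => π s = v)) else π s₀
  have hg : ∀ v, g v ∉ used := by
    intro v
    simp only [g]
    split_ifs with hv
    · exact (pick_spec _ hv.1).1
    · exact h₀
  have hC : ∀ v ∈ Function.periodicPts g, v ∉ used := by
    intro v hv
    obtain ⟨w, -, rfl⟩ := (Function.bijOn_periodicPts (f := g)).surjOn hv
    exact hg w
  obtain ⟨θ, hθ₁, hθ₂⟩ := exists_perm_eq_on_periodicPts g
  refine ⟨θ, ?_, fun u hu => hθ₂ u fun h => hC u h hu, ?_⟩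
  · rw [I.weight_perm_comp hI]
    refine add_le_add_right (Finset.sum_le_sum fun u _ => ?_) _
    -- A block on a cycle moves to its favourite, which is no dearer than its unused old user. A
    -- user on a cycle without a block carries the empty set, whose weight is zero for everyone.
    by_cases hu : u ∈ Function.periodicPts g
    · rw [hθ₁ u hu]
      by_cases hR : u ∈ R
      · simp only [g, if_pos hR]
        exact (pick_spec _ hR.1).2
      · have : (Finset.univ.filter fun s => π s = u) = ∅ := by
          refine Finset.filter_eq_empty_iff.2 fun s _ hs => hR ⟨hC u hu, s, hs⟩
        rw [this, setWeight_empty, setWeight_empty]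
    · rw [hθ₂ u hu]
  · obtain ⟨v, hv, hvR⟩ : ∃ v ∈ Function.periodicPts g, v ∈ R := by
      obtain ⟨x, hx⟩ := exists_mem_periodicPts g
      by_cases hR : x ∈ R
      · exact ⟨x, hx, hR⟩
      · refine ⟨g x, (Function.bijOn_periodicPts (f := g)).mapsTo hx, hg x, s₀, ?_⟩
        simp only [g, if_neg hR]
    obtain ⟨hvu, s₁, rfl⟩ := id hvR
    refine ⟨s₁, hvu, ?_⟩
    rw [hθ₁ _ hv]
    simp only [g, if_pos hvR]

/-- The value `k` marks the open steps; the blocks below `j` already follow the dictatorship. A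
round closes one whole block, hence at least one step: `j` grows by one while `d` drops by at least
one. So `j + d ≤ k` persists and the numbers of the closed blocks stay below `k`. -/
theorem exists_dictator_isOptimal_of_prefix (hI : I.UserIndependent) (d : ℕ) :
    ∀ (f : Fin k → ℕ) (π : Plan k n) (j : ℕ), I.IsOptimal π →
      (Finset.univ.filter fun s => f s = k).card = d → j + d ≤ k → (∀ s, f s < j ∨ f s = k) →
      (∀ s, f s < j → π s = I.dictator f (f s)) →
      (∀ s, f s = k → π s ∉ I.usedBefore f j) →
      ∃ f : Fin k → ℕ, (∀ s, f s < k) ∧ I.IsOptimal fun s => I.dictator f (f s) := by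
  induction d using Nat.strong_induction_on with
  | _ d ih =>
  intro f π j hopt hd hjd hf hdone hopen
  by_cases hex : ∃ s, f s = k
  swap
  · push Not at hex
    have hlt : ∀ s, f s < j := fun s => (hf s).resolve_right (hex s)
    refine ⟨f, fun s => (hlt s).trans_le (by omega), ?_⟩
    convert hopt using 1
    exact funext fun s => (hdone s (hlt s)).symm
  obtain ⟨s₀, hs₀⟩ := hex
  have hdpos : 0 < d := hd ▸ Finset.card_pos.2 ⟨s₀, by simpa using hs₀⟩
  have hjk : j < k := by omega
  obtain ⟨θ, hle, hfix, s₁, hs₁, hθ⟩ := I.exists_perm_trade hI π (I.usedBefore f j) (hopen s₀ hs₀)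
  have hblock : ∀ s, π s = π s₁ → f s = k := fun s hs => by
    refine (hf s).resolve_left fun h => hs₁ ?_
    rw [← hs, hdone s h]
    exact I.dictator_mem_usedBefore f h
  let f' : Fin k → ℕ := fun s => if π s = π s₁ then j else f s
  have hf'j : ∀ s, f' s = j ↔ π s = π s₁ := by
    intro s
    simp only [f']
    split_ifs with h
    · simpa using h
    · have := hf s
      exact ⟨fun e => by omega, fun e => absurd e h⟩
  have hagree : ∀ i < j, ∀ s, f' s = i ↔ f s = i := by
    intro i hi s
    simp only [f']
    split_ifs with h
    · have := hblock s h
      omega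
    · rfl
  have hdict : I.dictator f' j = θ (π s₁) := by
    rw [hθ, dictator, I.usedBefore_congr hagree]
    simp only [hf'j]
  have hopt' : I.IsOptimal (θ ∘ π) := fun π' => hle.trans (hopt π')
  have hdone' : ∀ s, f' s < j → f s = f' s ∧ f s < j := fun s h => by
    have := (hagree _ h s).1 rfl
    omega
  have hsub : (Finset.univ.filter fun s => f' s = k) ⊂ Finset.univ.filter fun s => f s = k := by
    refine (Finset.ssubset_iff_of_subset fun s => ?_).2 ⟨s₁, by simpa using hblock s₁ rfl, ?_⟩
    · simp only [Finset.mem_filter, Finset.mem_univ, true_and, f']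
      split_ifs with h
      · exact fun _ => hblock s h
      · exact id
    · simp only [Finset.mem_filter, Finset.mem_univ, true_and, (hf'j s₁).2 rfl]
      omega
  have hcard := Finset.card_lt_card hsub
  rw [hd] at hcard
  refine ih _ hcard f' (θ ∘ π) (j + 1) hopt' rfl (by omega) (fun s => ?_) (fun s hs => ?_)
    fun s hs => ?_
  · by_cases h : π s = π s₁
    · have := (hf'j s).2 h
      omega
    · have := hf s
      simp only [f', if_neg h]
      omega
  · rcases Nat.lt_succ_iff_lt_or_eq.1 hs with h | h
    · obtain ⟨e, hlt⟩ := hdone' s h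
      rw [I.dictator_congr h hagree, ← e, Function.comp_apply, hdone s hlt]
      exact hfix _ (I.dictator_mem_usedBefore f hlt)
    · rw [h, hdict, Function.comp_apply, (hf'j s).1 h]
  · have hne : π s ≠ π s₁ := fun h => by
      have := (hf'j s).2 h
      omega
    have hfs : f s = k := by simpa only [f', if_neg hne] using hs
    rw [usedBefore_succ, hdict, I.usedBefore_congr hagree, Finset.mem_insert, Function.comp_apply]
    -- The permutation is injective and fixes the used users, so it cannot move an open block onto
    -- the new dictator's user or onto an older one.
    rintro (h | h)
    · exact hne (θ.injective h)
    · have := θ.injective (hfix _ h)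
      exact hopen s hfs (this ▸ h)

/-- Some ordered partition of the steps leads the serial dictatorship to an optimal plan. -/
theorem exists_dictator_isOptimal (hI : I.UserIndependent) :
    ∃ f : Fin k → ℕ, (∀ s, f s < k) ∧ I.IsOptimal fun s => I.dictator f (f s) := by
  obtain ⟨π, hπ⟩ := Finite.exists_min I.weight
  exact I.exists_dictator_isOptimal_of_prefix hI k (fun _ => k) π 0 hπ (by simp) (by simp)
    (by simp) (by simp) (by simp [usedBefore])

end ValuedInstance


/-! ## Total correctness with time bounds -/

/-- Started in `σ`, the program halts within time `T` in a memory that satisfies `Q`. -/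
def Halts {k n m : ℕ} (I : ValuedInstance k n m) (τ : ℕ) (P : Program) (σ : Memory) (T : ℕ)
    (Q : Memory → Prop) : Prop :=
  ∃ σ' t, Runs I τ P σ σ' t ∧ t ≤ T ∧ Q σ'

/-- The two memories agree outside the registers `R` and the arrays `A`. -/
def Agree (R A : Finset ℕ) (σ σ' : Memory) : Prop :=
  (∀ x ∉ R, σ'.reg x = σ.reg x) ∧ ∀ a ∉ A, σ'.arr a = σ.arr a

namespace Agree

variable {R A R' A' : Finset ℕ} {σ σ₁ σ₂ : Memory}

theorem refl (R A : Finset ℕ) (σ : Memory) : Agree R A σ σ :=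
  ⟨fun _ _ => rfl, fun _ _ => rfl⟩

theorem trans (h₁ : Agree R A σ σ₁) (h₂ : Agree R A σ₁ σ₂) : Agree R A σ σ₂ :=
  ⟨fun x hx => (h₂.1 x hx).trans (h₁.1 x hx), fun a ha => (h₂.2 a ha).trans (h₁.2 a ha)⟩

theorem mono (h : Agree R A σ σ₁) (hR : R ⊆ R') (hA : A ⊆ A') : Agree R' A' σ σ₁ :=
  ⟨fun x hx => h.1 x fun h => hx (hR h), fun a ha => h.2 a fun h => ha (hA h)⟩

theorem setReg (h : Agree R A σ σ₁) {x : ℕ} (hx : x ∈ R) (v : ℤ) :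
    Agree R A σ (σ₁.setReg x v) := by
  refine ⟨fun y hy => ?_, h.2⟩
  rw [← h.1 y hy]
  exact Function.update_of_ne (by rintro rfl; exact hy hx) _ _

theorem setArr (h : Agree R A σ σ₁) {a : ℕ} (ha : a ∈ A) (i v : ℤ) :
    Agree R A σ (σ₁.setArr a i v) := by
  refine ⟨h.1, fun b hb => ?_⟩
  rw [← h.2 b hb]
  exact Function.update_of_ne (by rintro rfl; exact hb ha) _ _

end Agree

namespace Memory

variable (σ : Memory)

@[simp] theorem reg_setReg_self (x : ℕ) (v : ℤ) : (σ.setReg x v).reg x = v :=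
  Function.update_self _ _ _

theorem reg_setReg (x y : ℕ) (v : ℤ) :
    (σ.setReg x v).reg y = if y = x then v else σ.reg y := by
  simp [setReg, Function.update_apply]

@[simp] theorem arr_setReg (x : ℕ) (v : ℤ) : (σ.setReg x v).arr = σ.arr := rfl

@[simp] theorem reg_setArr (a : ℕ) (i v : ℤ) : (σ.setArr a i v).reg = σ.reg := rfl

theorem arr_setArr (a : ℕ) (i v : ℤ) (b : ℕ) (j : ℤ) :
    (σ.setArr a i v).arr b j = if b = a ∧ j = i then v else σ.arr b j := by
  by_cases hb : b = a
  · subst hb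
    simp [setArr, Function.update_apply]
  · simp [setArr, hb]

end Memory

section Rules

variable {k n m : ℕ} {I : ValuedInstance k n m} {τ : ℕ} {σ : Memory} {T T' : ℕ}
  {P P' : Program} {Q Q' : Memory → Prop}

theorem Halts.mono (h : Halts I τ P σ T Q) (hT : T ≤ T') (hQ : ∀ σ', Q σ' → Q' σ') :
    Halts I τ P σ T' Q' := by
  obtain ⟨σ', t, h₁, h₂, h₃⟩ := h
  exact ⟨σ', t, h₁, h₂.trans hT, hQ _ h₃⟩

theorem Halts.skip (h : Q σ) : Halts I τ .skip σ 1 Q :=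
  ⟨_, _, .skip σ, le_rfl, h⟩

theorem Halts.assign {x : ℕ} {e : Expr} (h : Q (σ.setReg x (e.eval σ))) :
    Halts I τ (.assign x e) σ (e.cost + 1) Q :=
  ⟨_, _, .assign σ x e, le_rfl, h⟩

theorem Halts.write {a : ℕ} {i e : Expr} (h : Q (σ.setArr a (i.eval σ) (e.eval σ))) :
    Halts I τ (.write a i e) σ (i.cost + e.cost + 1) Q :=
  ⟨_, _, .write σ a i e, le_rfl, h⟩

/-- The postcondition of the first program is the judgement about the second, so that proofs follow
the code forwards with all intermediate facts in scope. -/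
theorem Halts.seq (h : Halts I τ P σ T fun σ' => Halts I τ P' σ' T' Q) :
    Halts I τ (.seq P P') σ (T + T') Q := by
  obtain ⟨σ₁, t₁, h₁, ht₁, σ₂, t₂, h₂, ht₂, hQ⟩ := h
  exact ⟨σ₂, _, .seq h₁ h₂, by omega, hQ⟩

theorem Halts.cond {b : Test} (h : b.Holds σ → Halts I τ P σ T Q)
    (h' : ¬ b.Holds σ → Halts I τ P' σ T' Q) :
    Halts I τ (.cond b P P') σ (b.cost + 1 + max T T') Q := by
  by_cases hb : b.Holds σ
  · obtain ⟨σ', t, h₁, h₂, h₃⟩ := h hb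
    exact ⟨σ', _, .condTrue hb h₁, by omega, h₃⟩
  · obtain ⟨σ', t, h₁, h₂, h₃⟩ := h' hb
    exact ⟨σ', _, .condFalse hb h₁, by omega, h₃⟩

theorem Halts.queryCon {x : ℕ} {e : Expr} {a : ℕ} (c : Fin m) (π : Plan k n)
    (hc : e.eval σ = ((c : ℕ) : ℤ)) (hπ : ∀ s : Fin k, σ.arr a ((s : ℕ) : ℤ) = ((π s : ℕ) : ℤ))
    (h : Q (σ.setReg x (I.conWeight c π))) :
    Halts I τ (.queryCon x e a) σ (e.cost + 1 + k + τ) Q :=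
  ⟨_, _, .queryCon σ x e a c π hc hπ, le_rfl, h⟩

theorem Halts.querySet {x : ℕ} {e : Expr} {a : ℕ} (u : Fin n) (S : Finset (Fin k))
    (hu : e.eval σ = ((u : ℕ) : ℤ)) (hS : ∀ s : Fin k, s ∈ S ↔ σ.arr a ((s : ℕ) : ℤ) ≠ 0)
    (h : Q (σ.setReg x (I.setWeight S u))) :
    Halts I τ (.querySet x e a) σ (e.cost + 1 + k + τ) Q :=
  ⟨_, _, .querySet σ x e a u S hu hS, le_rfl, h⟩

/-- A loop whose body is repeated at most `N` times. -/
theorem Halts.loop {b : Test} {B : ℕ} (Inv : ℕ → Memory → Prop) (N : ℕ)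
    (hexit : ∀ σ, Inv N σ → ¬ b.Holds σ) (hgo : ∀ i < N, ∀ σ, Inv i σ → b.Holds σ)
    (step : ∀ i < N, ∀ σ, Inv i σ → Halts I τ P σ B (Inv (i + 1))) (h₀ : Inv 0 σ) :
    Halts I τ (.loop b P) σ (N * (B + b.cost + 1) + (b.cost + 1)) (Inv N) := by
  suffices h : ∀ d i σ, i + d = N → Inv i σ →
      Halts I τ (.loop b P) σ (d * (B + b.cost + 1) + (b.cost + 1)) (Inv N) from
    h N 0 σ (by omega) h₀
  intro d
  induction d with
  | zero =>
    intro i σ hi h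
    obtain rfl : i = N := by omega
    exact ⟨σ, _, .loopFalse (hexit σ h), by omega, h⟩
  | succ d ih =>
    intro i σ hi h
    obtain ⟨σ₁, s, h₁, hs, hI⟩ := step i (by omega) σ h
    obtain ⟨σ₂, t, h₂, ht, hQ⟩ := ih (i + 1) σ₁ (by omega) hI
    exact ⟨σ₂, _, .loopTrue (hgo i (by omega) σ h) h₁ h₂, by rw [Nat.succ_mul]; omega, hQ⟩

/-- Run `body` with register `x` counting from `0` up to the contents of register `r`. -/
def countingLoop (x r : ℕ) (body : Program) : Program :=
  .seq (.assign x (.const 0))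
    (.loop (.not (.le (.reg r) (.reg x)))
      (.seq body (.assign x (.add (.reg x) (.const 1)))))

/-- The invariant must not depend on the counter (`hx`), which the rule itself maintains. The 9
units per pass are 4 for the increment and 5 for the test; the final 7 are 2 for the initialisation
and 5 for the failing test. -/
theorem Halts.countingLoop {x r N B : ℕ} {body : Program} (Inv : ℕ → Memory → Prop)
    (hr : ∀ i σ, Inv i σ → σ.reg r = N) (hx : ∀ i σ v, Inv i σ → Inv i (σ.setReg x v))
    (step : ∀ i < N, ∀ σ, Inv i σ → σ.reg x = i →
      Halts I τ body σ B fun σ' => σ'.reg x = i ∧ Inv (i + 1) σ')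
    (h₀ : Inv 0 σ) (hQ : ∀ σ', Inv N σ' → Q σ') :
    Halts I τ (ValuedWSP.countingLoop x r body) σ (N * (B + 9) + 7) Q := by
  refine (Halts.seq (Halts.assign ((Halts.loop (B := B + 4)
    (fun i σ => Inv i σ ∧ σ.reg x = i) N ?_ ?_ ?_ ?_).mono le_rfl fun σ' h => hQ σ' h.1))).mono
      ?_ fun _ h => h
  · rintro σ ⟨h, hN⟩
    simp [Test.Holds, Expr.eval, hr _ _ h, hN]
  · rintro i hi σ ⟨h, hN⟩
    simp [Test.Holds, Expr.eval, hr _ _ h, hN, hi]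
  · rintro i hi σ ⟨h, hN⟩
    refine Halts.seq ((step i hi σ h hN).mono le_rfl ?_)
    rintro σ' ⟨hi', h'⟩
    refine Halts.assign ⟨hx _ _ _ h', ?_⟩
    simp [Expr.eval, hi']
  · exact ⟨hx _ _ _ h₀, by simp [Expr.eval]⟩
  · simp only [Expr.cost, Test.cost]
    have : N * (B + 4 + (1 + 1 + 1 + 1) + 1) = N * (B + 9) := rfl
    omega

end Rules


/-! ## The program

Registers: `3`–`6` are counters, `7` holds query results, `8`–`10` describe the cheapest user that
has been found, `11` holds the weight of the current plan, `12` and `13` tell whether a plan has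
been stored and its weight, and `14` is the carry. Arrays: `0` holds the best plan, `1` the current
map from the steps to the blocks, `2` the current plan, `3` the marks of the used users, and `4`
the characteristic vector of a set of steps. -/

/-- Put the characteristic vector of the set of all steps where array `a` has the value of
register `r` into array `4`. -/
def indicatorProgram (a r : ℕ) : Program :=
  countingLoop 3 0 (.cond (.eq (.read a (.reg 3)) (.reg r))
    (.write 4 (.reg 3) (.const 1)) (.write 4 (.reg 3) (.const 0)))

/-- Find the cheapest unused user for the set of steps in array `4`. -/
def scanProgram : Program :=
  .seq (.assign 8 (.const 0)) (.seq (.assign 9 (.const 0))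
    (countingLoop 4 1 (.cond (.eq (.read 3 (.reg 4)) (.const 0))
      (.seq (.querySet 7 (.reg 4) 4)
        (.cond (.and (.eq (.reg 8) (.const 1)) (.le (.reg 10) (.reg 7))) .skip
          (.seq (.assign 8 (.const 1)) (.seq (.assign 9 (.reg 4)) (.assign 10 (.reg 7))))))
      .skip)))

/-- Assign the block in register `5` to the user in register `9`. -/
def placeProgram : Program :=
  .seq (.write 3 (.reg 9) (.const 1))
    (countingLoop 3 0 (.cond (.eq (.read 1 (.reg 3)) (.reg 5))
      (.write 2 (.reg 3) (.reg 9)) .skip))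

/-- Run the serial dictatorship of the blocks in array `1`. -/
def dictatorProgram : Program :=
  .seq (countingLoop 4 1 (.write 3 (.reg 4) (.const 0)))
    (countingLoop 5 0 (.seq (indicatorProgram 1 5) (.seq scanProgram placeProgram)))

/-- Compute the weight of the plan in array `2`. -/
def weightProgram : Program :=
  .seq (.assign 11 (.const 0)) (.seq
    (countingLoop 6 2 (.seq (.queryCon 7 (.reg 6) 2) (.assign 11 (.add (.reg 11) (.reg 7)))))
    (countingLoop 4 1 (.seq (indicatorProgram 2 4)
      (.seq (.querySet 7 (.reg 4) 4) (.assign 11 (.add (.reg 11) (.reg 7)))))))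

/-- Store the plan in array `2` if it is better than the stored one. -/
def recordProgram : Program :=
  .cond (.and (.eq (.reg 12) (.const 1)) (.le (.reg 13) (.reg 11))) .skip
    (.seq (.assign 12 (.const 1)) (.seq (.assign 13 (.reg 11))
      (countingLoop 3 0 (.write 0 (.reg 3) (.read 2 (.reg 3))))))

/-- Increment the number in array `1` in base `k`. -/
def incrementProgram : Program :=
  .seq (.assign 14 (.const 1))
    (countingLoop 3 0 (.cond (.eq (.reg 14) (.const 1))
      (.cond (.eq (.add (.read 1 (.reg 3)) (.const 1)) (.reg 0))
        (.write 1 (.reg 3) (.const 0))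
        (.seq (.write 1 (.reg 3) (.add (.read 1 (.reg 3)) (.const 1))) (.assign 14 (.const 0))))
      .skip))

/-- Try the serial dictatorships of all maps from the steps to `k` blocks. -/
def solver : Program :=
  .cond (.eq (.reg 0) (.const 0)) .skip
    (.loop (.not (.eq (.reg 14) (.const 1)))
      (.seq dictatorProgram (.seq weightProgram (.seq recordProgram incrementProgram))))

/-! ### Loop invariants for one serial dictatorship -/

section

variable {k n m : ℕ} {I : ValuedInstance k n m} {τ : ℕ} {σ : Memory}

theorem halts_indicatorProgram {a r : ℕ} (ha : a ≠ 4) (hr : r ≠ 3) (hk : σ.reg 0 = k) :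
    Halts I τ (indicatorProgram a r) σ (k * 18 + 7) fun σ' => Agree {3} {4} σ σ' ∧
      ∀ s : Fin k, σ.arr a (s : ℕ) = σ.reg r ↔ σ'.arr 4 (s : ℕ) ≠ 0 := by
  refine (Halts.countingLoop (N := k) (B := 9) (fun i σ' => Agree {3} {4} σ σ' ∧
      ∀ s : Fin k, (s : ℕ) < i → (σ.arr a (s : ℕ) = σ.reg r ↔ σ'.arr 4 (s : ℕ) ≠ 0))
    ?_ ?_ ?_ ?_ ?_).mono (by omega) fun _ h => h
  · rintro i σ' ⟨h, -⟩
    rw [h.1 0 (by simp), hk]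
  · rintro i σ' v ⟨h, h'⟩
    exact ⟨h.setReg (by simp) v, h'⟩
  · rintro i hi σ' ⟨h, h'⟩ hx
    have hb : (Test.eq (.read a (.reg 3)) (.reg r)).Holds σ' ↔ σ.arr a i = σ.reg r := by
      simp only [Test.Holds, Expr.eval, hx]
      rw [h.1 r (by simpa using hr), h.2 a (by simpa using ha)]
    refine (Halts.cond (fun hc => Halts.write ⟨?_, h.setArr (by simp) _ _, ?_⟩)
      fun hc => Halts.write ⟨?_, h.setArr (by simp) _ _, ?_⟩).mono
        (by simp [Expr.cost, Test.cost]) fun _ h => h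
    · simpa using hx
    · intro s hs
      rw [hb] at hc
      rcases Nat.lt_succ_iff_lt_or_eq.1 hs with hs | hs
      · have : (s : ℤ) ≠ i := by omega
        simp [Memory.arr_setArr, Expr.eval, hx, h' s hs, this]
      · simp [Memory.arr_setArr, Expr.eval, hx, hs, hc]
    · simpa using hx
    · intro s hs
      rw [hb] at hc
      rcases Nat.lt_succ_iff_lt_or_eq.1 hs with hs | hs
      · have : (s : ℤ) ≠ i := by omega
        simp [Memory.arr_setArr, Expr.eval, hx, h' s hs, this]
      · simp [Memory.arr_setArr, Expr.eval, hx, hs, hc]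
  · exact ⟨Agree.refl _ _ _, by simp⟩
  · rintro σ' ⟨h, h'⟩
    exact ⟨h, fun s => h' s s.2⟩

theorem halts_scanProgram [NeZero n] {used : Finset (Fin n)} {S : Finset (Fin k)}
    (hn : σ.reg 1 = n) (hu : ∀ u : Fin n, σ.arr 3 (u : ℕ) = 0 ↔ u ∉ used)
    (hS : ∀ s : Fin k, s ∈ S ↔ σ.arr 4 (s : ℕ) ≠ 0) :
    Halts I τ scanProgram σ (n * (k + τ + 40) + 11) fun σ' =>
      Agree {4, 7, 8, 9, 10} ∅ σ σ' ∧
        σ'.reg 9 = ((pick used (I.setWeight S) : Fin n) : ℕ) := by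
  -- As long as no user has been found, register `9` holds `0`, the default value in `pick`.
  let Found (o : Option (Fin n)) (σ' : Memory) : Prop :=
    (o = none → σ'.reg 8 = 0 ∧ σ'.reg 9 = 0) ∧
      ∀ c, o = some c → σ'.reg 8 = 1 ∧ σ'.reg 9 = (c : ℕ) ∧ σ'.reg 10 = I.setWeight S c
  refine (Halts.seq (Halts.assign (Halts.seq (Halts.assign (Halts.countingLoop (N := n)
    (B := k + τ + 31)
    (fun i σ' => Agree {4, 7, 8, 9, 10} ∅ σ σ' ∧ Found (cheapest used (I.setWeight S) i) σ')
    ?_ ?_ ?_ ?_ ?_))))).mono ?_ fun _ h => h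
  · rintro i σ' ⟨h, -⟩
    rw [h.1 1 (by simp), hn]
  · rintro i σ' v ⟨h, h'⟩
    exact ⟨h.setReg (by simp) v, by simpa [Found, Memory.reg_setReg] using h'⟩
  · rintro i hi σ' ⟨h, h'⟩ hx
    have hb : (Test.eq (.read 3 (.reg 4)) (.const 0)).Holds σ' ↔ (⟨i, hi⟩ : Fin n) ∉ used := by
      simp only [Test.Holds, Expr.eval, hx]
      rw [h.2 3 (by simp), ← hu]
    refine (Halts.cond (fun hc => ?_) fun hc => ?_).mono (T := 5 + max (k + τ + 25) 1) ?_
      fun _ h => h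
    rotate_left
    · refine Halts.skip ⟨hx, h, ?_⟩
      rw [hb, not_not] at hc
      rwa [cheapest, dif_pos hi, if_pos hc]
    · omega
    rw [hb] at hc
    rw [cheapest, dif_pos hi, if_neg hc]
    refine (Halts.seq (Halts.querySet ⟨i, hi⟩ S (by simpa [Expr.eval] using hx)
      (fun s => by rw [h.2 4 (by simp)]; exact hS s) (Halts.cond (fun hd => ?_)
        fun hd => ?_))).mono (T := (2 + k + τ) + (8 + max 1 6)) ?_ fun _ h => h
    rotate_left
    · refine Halts.seq (Halts.assign (Halts.seq (Halts.assign (Halts.assign ⟨?_, ?_, ?_⟩))))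
      · simpa [Memory.reg_setReg] using hx
      · exact (((h.setReg (by simp) _).setReg (by simp) _).setReg (by simp) _).setReg (by simp) _
      · have : Found (some ⟨i, hi⟩) (((((σ'.setReg 7 (I.setWeight S ⟨i, hi⟩)).setReg 8 1).setReg 9
            i).setReg 10 (I.setWeight S ⟨i, hi⟩))) := by
          refine ⟨by simp, fun c e => ?_⟩
          obtain rfl : (⟨i, hi⟩ : Fin n) = c := by simpa using e
          simp [Memory.reg_setReg]
        cases hbest : cheapest used (I.setWeight S) i with
        | none => simpa [Expr.eval, Memory.reg_setReg, hx] using this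
        | some c =>
          obtain ⟨h8, h9, h10⟩ := h'.2 c hbest
          have hlt : ¬ I.setWeight S c ≤ I.setWeight S ⟨i, hi⟩ := by
            simpa [Test.Holds, Expr.eval, Memory.reg_setReg, h8, h10] using hd
          simpa [Expr.eval, Memory.reg_setReg, hx, hlt] using this
    · omega
    · refine Halts.skip ⟨?_, h.setReg (by simp) _, ?_⟩
      · simpa [Memory.reg_setReg] using hx
      · cases hbest : cheapest used (I.setWeight S) i with
        | none =>
          have := (h'.1 hbest).1
          simp [Test.Holds, Expr.eval, Memory.reg_setReg, this] at hd
        | some c =>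
          obtain ⟨h8, h9, h10⟩ := h'.2 c hbest
          have hle : I.setWeight S c ≤ I.setWeight S ⟨i, hi⟩ := by
            simpa [Test.Holds, Expr.eval, Memory.reg_setReg, h8, h10] using hd
          rw [hbest] at h'
          simpa [Found, Memory.reg_setReg, hle] using h'
  · refine ⟨((Agree.refl _ _ _).setReg (by simp) _).setReg (by simp) _, ?_⟩
    simp [Found, cheapest, Memory.reg_setReg, Expr.eval]
  · rintro σ' ⟨h, h₁, h₂⟩
    refine ⟨h, ?_⟩
    unfold pick
    cases hbest : cheapest used (I.setWeight S) n with
    | none => simpa using (h₁ hbest).2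
    | some c => simpa using (h₂ c hbest).2.1
  · simp only [Expr.cost]
    have : n * (k + τ + 31 + 9) = n * (k + τ + 40) := rfl
    omega

theorem halts_placeProgram {f : Fin k → ℕ} {i : ℕ} {u : Fin n} (hk : σ.reg 0 = k)
    (hi : σ.reg 5 = i) (hu : σ.reg 9 = (u : ℕ)) (hf : ∀ s : Fin k, σ.arr 1 (s : ℕ) = f s) :
    Halts I τ placeProgram σ (k * 17 + 10) fun σ' => Agree {3} {2, 3} σ σ' ∧
      (∀ v : Fin n, σ'.arr 3 (v : ℕ) = 0 ↔ v ≠ u ∧ σ.arr 3 (v : ℕ) = 0) ∧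
        ∀ s : Fin k, σ'.arr 2 (s : ℕ) = if f s = i then ((u : ℕ) : ℤ) else σ.arr 2 (s : ℕ) := by
  refine (Halts.seq (Halts.write (Halts.countingLoop (N := k) (B := 8)
    (fun j σ' => Agree {3} {2, 3} σ σ' ∧
      (∀ v : Fin n, σ'.arr 3 (v : ℕ) = 0 ↔ v ≠ u ∧ σ.arr 3 (v : ℕ) = 0) ∧
        ∀ s : Fin k, σ'.arr 2 (s : ℕ) =
          if (s : ℕ) < j ∧ f s = i then ((u : ℕ) : ℤ) else σ.arr 2 (s : ℕ))
    ?_ ?_ ?_ ?_ ?_))).mono ?_ fun _ h => h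
  · rintro j σ' ⟨h, -⟩
    rw [h.1 0 (by simp), hk]
  · rintro j σ' v ⟨h, h'⟩
    exact ⟨h.setReg (by simp) v, h'⟩
  · rintro j hj σ' ⟨h, h₃, h₂⟩ hx
    have hb : (Test.eq (.read 1 (.reg 3)) (.reg 5)).Holds σ' ↔ f ⟨j, hj⟩ = i := by
      simp only [Test.Holds, Expr.eval, hx]
      rw [h.2 1 (by simp), h.1 5 (by simp), hf ⟨j, hj⟩, hi]
      exact Nat.cast_inj
    have h9 : σ'.reg 9 = (u : ℕ) := by rw [h.1 9 (by simp), hu]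
    refine (Halts.cond (fun hc => Halts.write ⟨by simpa using hx, h.setArr (by simp) _ _, ?_, ?_⟩)
      fun hc => Halts.skip ⟨hx, h, h₃, ?_⟩).mono (by simp [Expr.cost, Test.cost]) fun _ h => h
    · simpa [Memory.arr_setArr] using h₃
    · intro s
      rw [hb] at hc
      by_cases hs : (s : ℕ) = j
      · obtain rfl : s = ⟨j, hj⟩ := Fin.ext hs
        simp [Memory.arr_setArr, Expr.eval, hx, hc, h9]
      · have h₁ : (s : ℕ) < j + 1 ↔ (s : ℕ) < j := by omega
        simp [Memory.arr_setArr, Expr.eval, hx, hs, h₁, h₂]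
    · intro s
      rw [hb] at hc
      rw [h₂]
      by_cases hs : (s : ℕ) = j
      · obtain rfl : s = ⟨j, hj⟩ := Fin.ext hs
        simp [hc]
      · have h₁ : (s : ℕ) < j + 1 ↔ (s : ℕ) < j := by omega
        simp [h₁]
  · refine ⟨(Agree.refl _ _ _).setArr (by simp) _ _, fun v => ?_, by simp [Memory.arr_setArr]⟩
    by_cases hv : v = u
    · simp [Memory.arr_setArr, Expr.eval, hu, hv]
    · have : (v : ℕ) ≠ u := fun h => hv (Fin.ext h)
      simp [Memory.arr_setArr, Expr.eval, hu, hv, this]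
  · rintro σ' ⟨h, h₃, h₂⟩
    exact ⟨h, h₃, fun s => by simp [h₂]⟩
  · simp only [Expr.cost]
    omega

/-- The marks are cleared first because those of the previous candidate may remain. A number that
`f` omits gives an empty block, which still uses up a user, in the program as in `usedBefore`. -/
theorem halts_dictatorProgram [NeZero n] {f : Fin k → ℕ} (hk : σ.reg 0 = k) (hn : σ.reg 1 = n)
    (hf : ∀ s : Fin k, σ.arr 1 (s : ℕ) = f s) (hlt : ∀ s, f s < k) :
    Halts I τ dictatorProgram σ (n * 12 + k * (k * 35 + n * (k + τ + 40) + 37) + 14) fun σ' =>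
      Agree {3, 4, 5, 7, 8, 9, 10} {2, 3, 4} σ σ' ∧
        ∀ s : Fin k, σ'.arr 2 (s : ℕ) = ((I.dictator f (f s) : Fin n) : ℕ) := by
  refine (Halts.seq (T := n * (3 + 9) + 7) (Halts.countingLoop (N := n) (B := 3)
    (fun i σ' => Agree {3, 4, 5, 7, 8, 9, 10} {2, 3, 4} σ σ' ∧
      ∀ u : Fin n, (u : ℕ) < i → σ'.arr 3 (u : ℕ) = 0) ?_ ?_ ?_ ?_ ?_)).mono
    (T := n * (3 + 9) + 7 + (k * (k * 35 + n * (k + τ + 40) + 28 + 9) + 7)) ?_ fun _ h => h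
  · rintro i σ' ⟨h, -⟩
    rw [h.1 1 (by simp), hn]
  · rintro i σ' v ⟨h, h'⟩
    exact ⟨h.setReg (by simp) v, h'⟩
  · rintro i hi σ' ⟨h, h'⟩ hx
    refine Halts.write ⟨by simpa using hx, h.setArr (by simp) _ _, fun u hu => ?_⟩
    by_cases hui : (u : ℕ) = i
    · simp [Memory.arr_setArr, Expr.eval, hui, hx]
    · simp [Memory.arr_setArr, Expr.eval, hui, hx, h' u (by omega)]
  · exact ⟨Agree.refl _ _ _, by simp⟩
  · rintro σ₁ ⟨h₁, hz⟩
    refine Halts.countingLoop (N := k) (fun i σ' => Agree {3, 4, 5, 7, 8, 9, 10} {2, 3, 4} σ σ' ∧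
      (∀ u : Fin n, σ'.arr 3 (u : ℕ) = 0 ↔ u ∉ I.usedBefore f i) ∧
        ∀ s : Fin k, f s < i → σ'.arr 2 (s : ℕ) = ((I.dictator f (f s) : Fin n) : ℕ))
      ?_ ?_ ?_ ?_ ?_
    · rintro i σ' ⟨h, -⟩
      rw [h.1 0 (by simp), hk]
    · rintro i σ' v ⟨h, h'⟩
      exact ⟨h.setReg (by simp) v, h'⟩
    · rintro i hi σ' ⟨h, hu, hp⟩ hx
      have hf' : ∀ s : Fin k, σ'.arr 1 (s : ℕ) = f s := fun s => by rw [h.2 1 (by simp), hf]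
      have hk' : σ'.reg 0 = k := by rw [h.1 0 (by simp), hk]
      have hn' : σ'.reg 1 = n := by rw [h.1 1 (by simp), hn]
      refine (Halts.seq ((halts_indicatorProgram (by simp) (by simp) hk').mono le_rfl ?_)).mono
        (T := k * 18 + 7 + (n * (k + τ + 40) + 11 + (k * 17 + 10))) (by omega) fun _ h => h
      rintro σ₂ ⟨h₂, hχ⟩
      refine Halts.seq ((halts_scanProgram (S := Finset.univ.filter fun s => f s = i)
        (used := I.usedBefore f i) ?_ ?_ ?_).mono le_rfl ?_)
      · rw [h₂.1 1 (by simp), hn']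
      · intro u
        rw [h₂.2 3 (by simp), hu]
      · intro s
        rw [← hχ, hf', hx]
        simp
      rintro σ₃ ⟨h₃, hpick⟩
      have h₂₃ : Agree {3, 4, 7, 8, 9, 10} {4} σ' σ₃ :=
        (h₂.mono (by simp) (by simp)).trans (h₃.mono (by simp) (by simp))
      refine (halts_placeProgram (f := f) (i := i) (u := I.dictator f i) ?_ ?_ hpick ?_).mono
        le_rfl ?_
      · rw [h₂₃.1 0 (by simp), hk']
      · rw [h₂₃.1 5 (by simp), hx]
      · intro s
        rw [h₂₃.2 1 (by simp), hf']
      rintro σ₄ ⟨h₄, hu₄, hp₄⟩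
      have h₂₄ : Agree {3, 4, 7, 8, 9, 10} {2, 3, 4} σ' σ₄ :=
        (h₂₃.mono (by simp) (by simp)).trans (h₄.mono (by simp) (by simp))
      refine ⟨by rw [h₂₄.1 5 (by simp), hx], h.trans (h₂₄.mono (by decide) (by simp)),
        fun u => ?_, fun s hs => ?_⟩
      · rw [hu₄, h₂₃.2 3 (by simp), hu, I.usedBefore_succ]
        simp
      · rw [hp₄]
        split_ifs with hsi
        · rw [hsi]
        · rw [h₂₃.2 2 (by simp), hp s (by omega)]
    · refine ⟨h₁, fun u => ?_, by simp⟩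
      simp [hz u u.2, ValuedInstance.usedBefore]
    · rintro σ' ⟨h, -, hp⟩
      exact ⟨h, fun s => hp s (hlt s)⟩
  · have : k * (k * 35 + n * (k + τ + 40) + 28 + 9) = k * (k * 35 + n * (k + τ + 40) + 37) := rfl
    omega

end


/-! ### Partial sums and counting in base `k` -/

theorem sum_filter_lt_succ {N i : ℕ} (hi : i < N) (w : Fin N → ℤ) :
    ∑ c with (c : Fin N).val < i + 1, w c = (∑ c with (c : Fin N).val < i, w c) + w ⟨i, hi⟩ := by
  have : (Finset.univ.filter fun c : Fin N => (c : ℕ) < i + 1) =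
      insert ⟨i, hi⟩ (Finset.univ.filter fun c : Fin N => (c : ℕ) < i) := by
    ext c
    simp [Fin.ext_iff]
    omega
  rw [this, Finset.sum_insert (by simp), add_comm]

/-- With `q = k ^ i`, a carry reaches digit `i` exactly when `q ∣ N + 1`, since only then does the
quotient by `q` grow. It is passed on exactly when that digit is also `k - 1`. -/
theorem digit_succ {k N q : ℕ} (hk : 0 < k) :
    (k * q ∣ N + 1 ↔ q ∣ N + 1 ∧ N / q % k + 1 = k) ∧
      ((N + 1) / q % k = if q ∣ N + 1 then if N / q % k + 1 = k then 0 else N / q % k + 1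
        else N / q % k) := by
  have hlt := Nat.mod_lt (N / q) hk
  have hmod : (N / q + 1) % k = if N / q % k + 1 = k then 0 else N / q % k + 1 := by
    rw [Nat.add_mod]
    split_ifs with h
    · rcases Nat.lt_or_ge 1 k with h1 | h1
      · rw [Nat.mod_eq_of_lt h1, h, Nat.mod_self]
      · obtain rfl : k = 1 := by omega
        simp [Nat.mod_one]
    · rw [Nat.mod_eq_of_lt (by omega : 1 < k), Nat.mod_eq_of_lt (by omega)]
  by_cases hq : q ∣ N + 1
  · have hdiv : (N + 1) / q = N / q + 1 := Nat.succ_div_of_dvd hq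
    rw [if_pos hq, hdiv, hmod]
    refine ⟨⟨fun h => ⟨hq, ?_⟩, fun h => ?_⟩, rfl⟩
    · have : k ∣ (N + 1) / q := by
        obtain ⟨c, hc⟩ := h
        rcases Nat.eq_zero_or_pos q with rfl | hpos
        · simp at hc
        · exact ⟨c, by rw [hc, Nat.mul_assoc, Nat.mul_left_comm, Nat.mul_div_cancel_left _ hpos]⟩
      rw [hdiv, Nat.dvd_iff_mod_eq_zero, hmod] at this
      by_contra hne
      rw [if_neg hne] at this
      omega
    · have : k ∣ (N + 1) / q := by
        rw [hdiv, Nat.dvd_iff_mod_eq_zero, hmod, if_pos h.2]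
      obtain ⟨c, hc⟩ := this
      refine ⟨c, ?_⟩
      rw [← Nat.div_mul_cancel hq, hc]
      ring
  · rw [if_neg hq, Nat.succ_div_of_not_dvd hq]
    exact ⟨⟨fun h => absurd ((Dvd.intro_left k rfl).trans h) hq, fun h => absurd h.1 hq⟩, rfl⟩

theorem exists_digits_eq {k : ℕ} (f : Fin k → ℕ) (hf : ∀ s, f s < k) :
    ∃ N < k ^ k, ∀ s : Fin k, N / k ^ (s : ℕ) % k = f s := by
  let g : Fin k → Fin k := fun s => ⟨f s, hf s⟩
  refine ⟨finFunctionFinEquiv g, (finFunctionFinEquiv g).2, fun s => ?_⟩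
  rw [← finFunctionFinEquiv_symm_apply_val, Equiv.symm_apply_apply]

/-! ### Evaluating, recording and enumerating the candidates -/

section

variable {k n m : ℕ} {I : ValuedInstance k n m} {τ : ℕ} {σ : Memory}

theorem halts_weightProgram {π : Plan k n} (hk : σ.reg 0 = k) (hn : σ.reg 1 = n)
    (hm : σ.reg 2 = m) (hπ : ∀ s : Fin k, σ.arr 2 (s : ℕ) = (π s : ℕ)) :
    Halts I τ weightProgram σ (m * (k + τ + 15) + n * (k * 19 + τ + 22) + 16) fun σ' =>
      Agree {3, 4, 6, 7, 11} {4} σ σ' ∧ σ'.reg 11 = I.weight π := by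
  refine (Halts.seq (Halts.assign (Halts.seq (Halts.countingLoop (N := m) (B := k + τ + 6)
    (fun i σ' => Agree {3, 4, 6, 7, 11} {4} σ σ' ∧
      σ'.reg 11 = ∑ c with (c : Fin m).val < i, I.conWeight c π)
    ?_ ?_ ?_ ?_ ?_)))).mono
    (T := 2 + ((m * (k + τ + 6 + 9) + 7) + (n * (k * 19 + τ + 13 + 9) + 7))) ?_ fun _ h => h
  · rintro i σ' ⟨h, -⟩
    rw [h.1 2 (by simp), hm]
  · rintro i σ' v ⟨h, h'⟩
    exact ⟨h.setReg (by simp) v, by simpa [Memory.reg_setReg] using h'⟩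
  · rintro i hi σ' ⟨h, h'⟩ hx
    refine (Halts.seq (Halts.queryCon ⟨i, hi⟩ π (by simpa [Expr.eval] using hx)
      (fun s => by rw [h.2 2 (by simp), hπ]) (Halts.assign ⟨?_, ?_, ?_⟩))).mono
        (by simp only [Expr.cost]; omega) fun _ h => h
    · simpa [Memory.reg_setReg] using hx
    · exact (h.setReg (by simp) _).setReg (by simp) _
    · rw [sum_filter_lt_succ hi]
      simp [Memory.reg_setReg, Expr.eval, h']
  · exact ⟨(Agree.refl _ _ _).setReg (by simp) _, by simp [Expr.eval]⟩
  · rintro σ₁ ⟨h₁, hw₁⟩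
    refine Halts.countingLoop (N := n) (fun i σ' => Agree {3, 4, 6, 7, 11} {4} σ σ' ∧
      σ'.reg 11 = I.constraintWeight π + ∑ u with (u : Fin n).val < i,
        I.setWeight (Finset.univ.filter fun s => π s = u) u) ?_ ?_ ?_ ?_ ?_
    · rintro i σ' ⟨h, -⟩
      rw [h.1 1 (by simp), hn]
    · rintro i σ' v ⟨h, h'⟩
      exact ⟨h.setReg (by simp) v, by simpa [Memory.reg_setReg] using h'⟩
    · rintro i hi σ' ⟨h, h'⟩ hx
      have hk' : σ'.reg 0 = k := by rw [h.1 0 (by simp), hk]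
      refine (Halts.seq ((halts_indicatorProgram (by simp) (by simp) hk').mono le_rfl ?_)).mono
        (T := k * 18 + 7 + (2 + k + τ + 4)) (by omega) fun _ h => h
      rintro σ₂ ⟨h₂, hχ⟩
      have hx₂ : σ₂.reg 4 = i := by rw [h₂.1 4 (by simp), hx]
      refine Halts.seq (Halts.querySet ⟨i, hi⟩ (Finset.univ.filter fun s => π s = ⟨i, hi⟩)
        (by simpa [Expr.eval] using hx₂) (fun s => ?_) (Halts.assign ⟨?_, ?_, ?_⟩))
      · rw [← hχ, h.2 2 (by simp), hπ, hx]
        simp [Fin.ext_iff]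
      · simpa [Memory.reg_setReg] using hx₂
      · exact ((h.trans (h₂.mono (by simp) (by simp))).setReg (by simp) _).setReg (by simp) _
      · rw [sum_filter_lt_succ hi]
        simp [Memory.reg_setReg, Expr.eval, h₂.1 11, h', add_assoc]
    · refine ⟨h₁, ?_⟩
      simp [hw₁, ValuedInstance.constraintWeight]
    · rintro σ' ⟨h, h'⟩
      refine ⟨h, h'.trans ?_⟩
      simp [ValuedInstance.weight, ValuedInstance.authorisationWeight]
  · have h₁ : m * (k + τ + 6 + 9) = m * (k + τ + 15) := rfl
    have h₂ : n * (k * 19 + τ + 13 + 9) = n * (k * 19 + τ + 22) := rfl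
    omega

/-- Weights are nonnegative and register `13` starts at `0`, so a comparison with it makes sense
only once the flag in register `12` is set. -/
theorem halts_recordProgram {π : Plan k n} (hk : σ.reg 0 = k)
    (hπ : ∀ s : Fin k, σ.arr 2 (s : ℕ) = (π s : ℕ)) (hw : σ.reg 11 = I.weight π)
    (hbest : σ.reg 12 = 1 → ∃ ρ : Plan k n, (∀ s : Fin k, σ.arr 0 (s : ℕ) = (ρ s : ℕ)) ∧
      σ.reg 13 = I.weight ρ) :
    Halts I τ recordProgram σ (k * 13 + 19) fun σ' => Agree {3, 12, 13} {0} σ σ' ∧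
      σ'.reg 12 = 1 ∧ (σ.reg 12 = 1 → σ'.reg 13 ≤ σ.reg 13) ∧ σ'.reg 13 ≤ I.weight π ∧
        ∃ ρ : Plan k n, (∀ s : Fin k, σ'.arr 0 (s : ℕ) = (ρ s : ℕ)) ∧
          σ'.reg 13 = I.weight ρ := by
  refine (Halts.cond (T := 1) (T' := 2 + (2 + (k * (4 + 9) + 7))) (fun hb => Halts.skip ?_)
    fun hb => Halts.seq (Halts.assign (Halts.seq (Halts.assign
      (Halts.countingLoop (N := k) (B := 4) (fun i σ' => Agree {3, 12, 13} {0} σ σ' ∧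
        σ'.reg 12 = 1 ∧ σ'.reg 13 = I.weight π ∧
          ∀ s : Fin k, (s : ℕ) < i → σ'.arr 0 (s : ℕ) = (π s : ℕ)) ?_ ?_ ?_ ?_ ?_))))).mono
      ?_ fun _ h => h
  · have hb' : σ.reg 12 = 1 ∧ σ.reg 13 ≤ σ.reg 11 := by
      simpa [Test.Holds, Expr.eval] using hb
    exact ⟨Agree.refl _ _ _, hb'.1, fun _ => le_rfl, hw ▸ hb'.2, hbest hb'.1⟩
  · rintro i σ' ⟨h, -⟩
    rw [h.1 0 (by simp), hk]
  · rintro i σ' v ⟨h, h'⟩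
    exact ⟨h.setReg (by simp) v, by simpa [Memory.reg_setReg] using h'⟩
  · rintro i hi σ' ⟨h, h12, h13, h'⟩ hx
    refine Halts.write ⟨by simpa using hx, h.setArr (by simp) _ _, by simpa using h12,
      by simpa using h13, fun s hs => ?_⟩
    by_cases hsi : (s : ℕ) = i
    · subst hsi
      simp [Memory.arr_setArr, Expr.eval, hx, h.2 2, hπ]
    · simp [Memory.arr_setArr, Expr.eval, hx, hsi, h' s (by omega)]
  · refine ⟨((Agree.refl _ _ _).setReg (by simp) _).setReg (by simp) _, ?_⟩
    simp [Memory.reg_setReg, Expr.eval, hw]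
  · rintro σ' ⟨h, h12, h13, h'⟩
    refine ⟨h, h12, fun hs => ?_, h13.le, π, fun s => h' s s.2, h13⟩
    have : ¬ σ.reg 13 ≤ σ.reg 11 := by simpa [Test.Holds, Expr.eval, hs] using hb
    omega
  · simp only [Expr.cost, Test.cost]
    omega

/-- Before digit `i` is treated, the carry is set exactly when `k ^ i ∣ N + 1`. The carry left after
the last digit therefore signals overflow. -/
theorem halts_incrementProgram {N : ℕ} (hk : σ.reg 0 = k)
    (hN : ∀ s : Fin k, σ.arr 1 (s : ℕ) = (N / k ^ (s : ℕ) % k : ℕ)) :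
    Halts I τ incrementProgram σ (k * 28 + 9) fun σ' => Agree {3, 14} {1} σ σ' ∧
      (∀ s : Fin k, σ'.arr 1 (s : ℕ) = ((N + 1) / k ^ (s : ℕ) % k : ℕ)) ∧
        (σ'.reg 14 = 1 ↔ k ^ k ∣ N + 1) := by
  refine (Halts.seq (Halts.assign (Halts.countingLoop (N := k) (B := 19)
    (fun i σ' => Agree {3, 14} {1} σ σ' ∧
      (∀ s : Fin k, σ'.arr 1 (s : ℕ) =
        if (s : ℕ) < i then (((N + 1) / k ^ (s : ℕ) % k : ℕ) : ℤ)
        else (N / k ^ (s : ℕ) % k : ℕ)) ∧ (σ'.reg 14 = 1 ↔ k ^ i ∣ N + 1))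
    ?_ ?_ ?_ ?_ ?_))).mono ?_ fun _ h => h
  · rintro i σ' ⟨h, -⟩
    rw [h.1 0 (by simp), hk]
  · rintro i σ' v ⟨h, h₁, h₂⟩
    exact ⟨h.setReg (by simp) v, h₁, by simpa [Memory.reg_setReg] using h₂⟩
  · rintro i hi σ' ⟨h, h₁, h₂⟩ hx
    obtain ⟨hdvd, hdigit⟩ := digit_succ (k := k) (N := N) (q := k ^ i) (by omega)
    rw [← Nat.pow_succ'] at hdvd
    have hk' : σ'.reg 0 = k := by rw [h.1 0 (by simp), hk]
    have hi₁ : σ'.arr 1 i = (N / k ^ i % k : ℕ) := by simpa using h₁ ⟨i, hi⟩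
    have hother : ∀ s : Fin k, (s : ℕ) ≠ i → σ'.arr 1 (s : ℕ) =
        if (s : ℕ) < i + 1 then (((N + 1) / k ^ (s : ℕ) % k : ℕ) : ℤ)
        else (N / k ^ (s : ℕ) % k : ℕ) := by
      intro s hs
      have : (s : ℕ) < i + 1 ↔ (s : ℕ) < i := by omega
      rw [h₁]
      simp only [this]
    have hwrite : ∀ v : ℤ, v = ((N + 1) / k ^ i % k : ℕ) → ∀ s : Fin k,
        (σ'.setArr 1 i v).arr 1 (s : ℕ) =
          if (s : ℕ) < i + 1 then (((N + 1) / k ^ (s : ℕ) % k : ℕ) : ℤ)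
          else (N / k ^ (s : ℕ) % k : ℕ) := by
      intro v hv s
      by_cases hs : (s : ℕ) = i
      · rw [Memory.arr_setArr, if_pos ⟨rfl, by rw [hs]⟩, if_pos (by omega), hv, hs]
      · rw [Memory.arr_setArr, if_neg (by omega), hother s hs]
    have hb₁ : (Test.eq (.reg 14) (.const 1)).Holds σ' ↔ k ^ i ∣ N + 1 := h₂
    have hb₂ : (Test.eq (.add (.read 1 (.reg 3)) (.const 1)) (.reg 0)).Holds σ' ↔
        N / k ^ i % k + 1 = k := by
      simp only [Test.Holds, Expr.eval, hx, hi₁, hk']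
      omega
    refine (Halts.cond (fun hc => Halts.cond (fun hd => Halts.write ⟨?_, h.setArr (by simp) _ _,
        ?_, ?_⟩) fun hd => Halts.seq (Halts.write (Halts.assign ⟨?_,
          (h.setArr (by simp) _ _).setReg (by simp) _, ?_, ?_⟩)))
      fun hc => Halts.skip ⟨?_, h, ?_, ?_⟩).mono ?_ fun _ h => h
    · simp [Expr.cost, Test.cost]
    · simpa using hx
    · rw [hb₁] at hc
      rw [hb₂] at hd
      have := hwrite 0 (by rw [hdigit, if_pos hc, if_pos hd]; rfl)
      simpa [Expr.eval, hx] using this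
    · rw [hb₁] at hc
      rw [hb₂] at hd
      rw [hdvd, Memory.reg_setArr, h₂]
      exact ⟨fun _ => ⟨hc, hd⟩, fun _ => hc⟩
    · simpa [Memory.reg_setReg] using hx
    · rw [hb₁] at hc
      rw [hb₂] at hd
      have := hwrite (σ'.arr 1 i + 1) (by rw [hdigit, if_pos hc, if_neg hd, hi₁]; simp)
      simpa [Expr.eval, hx] using this
    · rw [hb₂] at hd
      rw [hdvd]
      simp [Expr.eval, hd]
    · exact hx
    · rw [hb₁] at hc
      intro s
      by_cases hs : (s : ℕ) = i
      · rw [hs, if_pos (by omega), hdigit, if_neg hc, hi₁]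
      · exact hother s hs
    · rw [hb₁] at hc
      rw [hdvd, h₂]
      tauto
  · exact ⟨(Agree.refl _ _ _).setReg (by simp) _, by simpa using hN, by simp [Expr.eval]⟩
  · rintro σ' ⟨h, h₁, h₂⟩
    exact ⟨h, fun s => by simp [h₁], h₂⟩
  · simp only [Expr.cost]
    omega

/-- The time for one candidate of the solver. -/
def roundTime (k n m τ : ℕ) : ℕ :=
  n * 12 + k * (k * 35 + n * (k + τ + 40) + 37) + 14 +
    (m * (k + τ + 15) + n * (k * 19 + τ + 22) + 16 + (k * 13 + 19 + (k * 28 + 9)))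

theorem solver_spec [NeZero n] (hI : I.UserIndependent) (hk0 : 0 < k) :
    ∃ t, SolvesInTime solver I τ t ∧ t ≤ k ^ k * (roundTime k n m τ + 5) + 10 := by
  let cand (N : ℕ) : Plan k n := fun s => I.dictator (fun s => N / k ^ (s : ℕ) % k)
    (N / k ^ (s : ℕ) % k)
  -- State after `N` candidates. The condition `0 < N` separates the start, where `k ^ k ∣ 0` but no
  -- carry is set, from the wrap-around.
  let Inv (N : ℕ) (σ : Memory) : Prop := σ.reg 0 = k ∧ σ.reg 1 = n ∧ σ.reg 2 = m ∧
    (∀ s : Fin k, σ.arr 1 (s : ℕ) = (N / k ^ (s : ℕ) % k : ℕ)) ∧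
    (σ.reg 14 = 1 ↔ 0 < N ∧ k ^ k ∣ N) ∧
    (∀ N' < N, σ.reg 12 = 1 ∧ σ.reg 13 ≤ I.weight (cand N')) ∧
    (σ.reg 12 = 1 → ∃ ρ : Plan k n, (∀ s : Fin k, σ.arr 0 (s : ℕ) = (ρ s : ℕ)) ∧
      σ.reg 13 = I.weight ρ)
  have hpow : 0 < k ^ k := by positivity
  have key : Halts I τ solver (initialMemory k n m)
      (3 + 1 + max 1 (k ^ k * (roundTime k n m τ + 4 + 1) + (4 + 1))) (Inv (k ^ k)) := by
    refine Halts.cond (fun h => ?_) fun _ => Halts.loop Inv (k ^ k) ?_ ?_ ?_ ?_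
    · have : k = 0 := by simpa [Test.Holds, Expr.eval, initialMemory] using h
      omega
    · rintro σ ⟨-, -, -, -, h, -⟩
      simpa [Test.Holds, Expr.eval] using h.2 ⟨hpow, dvd_rfl⟩
    · rintro N hN σ ⟨-, -, -, -, h, -⟩
      simp only [Test.Holds, Expr.eval, h]
      exact fun h => absurd (Nat.le_of_dvd h.1 h.2) (by omega)
    · rintro N hN σ ⟨hk, hn, hm, hdig, -, hle, hbest⟩
      refine Halts.seq ((halts_dictatorProgram hk hn hdig fun s => Nat.mod_lt _ hk0).mono
        le_rfl ?_)
      rintro σ₁ ⟨h₁, hπ⟩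
      refine Halts.seq ((halts_weightProgram (π := cand N) ?_ ?_ ?_ hπ).mono le_rfl ?_)
      · rw [h₁.1 0 (by simp), hk]
      · rw [h₁.1 1 (by simp), hn]
      · rw [h₁.1 2 (by simp), hm]
      rintro σ₂ ⟨h₂, hw⟩
      have h₁₂ : Agree {3, 4, 5, 6, 7, 8, 9, 10, 11} {2, 3, 4} σ σ₂ :=
        (h₁.mono (by decide) (by simp)).trans (h₂.mono (by decide) (by simp))
      refine Halts.seq ((halts_recordProgram (π := cand N) ?_ ?_ hw ?_).mono le_rfl ?_)
      · rw [h₁₂.1 0 (by simp), hk]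
      · intro s
        rw [h₂.2 2 (by simp)]
        exact hπ s
      · rw [h₁₂.1 12 (by simp), h₁₂.1 13 (by simp), h₁₂.2 0 (by simp)]
        exact hbest
      rintro σ₃ ⟨h₃, h12, hmono, hnew, hbest₃⟩
      have h₁₃ : Agree {3, 4, 5, 6, 7, 8, 9, 10, 11, 12, 13} {0, 2, 3, 4} σ σ₃ :=
        (h₁₂.mono (by decide) (by simp)).trans (h₃.mono (by decide) (by simp))
      refine (halts_incrementProgram (N := N) ?_ ?_).mono le_rfl ?_
      · rw [h₁₃.1 0 (by simp), hk]
      · intro s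
        rw [h₁₃.2 1 (by simp), hdig]
      rintro σ₄ ⟨h₄, hdig₄, hc⟩
      refine ⟨?_, ?_, ?_, hdig₄, by simpa using hc, fun N' hN' => ⟨?_, ?_⟩, fun _ => ?_⟩
      · rw [h₄.1 0 (by simp), h₁₃.1 0 (by simp), hk]
      · rw [h₄.1 1 (by simp), h₁₃.1 1 (by simp), hn]
      · rw [h₄.1 2 (by simp), h₁₃.1 2 (by simp), hm]
      · rw [h₄.1 12 (by simp), h12]
      · rw [h₄.1 13 (by simp)]
        rcases Nat.lt_succ_iff_lt_or_eq.1 hN' with h | rfl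
        · obtain ⟨h12', h13'⟩ := hle N' h
          rw [h₁₂.1 12 (by simp), h₁₂.1 13 (by simp)] at hmono
          exact (hmono h12').trans h13'
        · exact hnew
      · rw [h₄.1 13 (by simp), h₄.2 0 (by simp)]
        exact hbest₃
    · simp [Inv, initialMemory]
  obtain ⟨σ, t, hrun, ht, -, -, -, -, -, hle, hbest⟩ := key
  obtain ⟨ρ, hρ, hw⟩ := hbest (hle 0 hpow).1
  have h5 : roundTime k n m τ + 4 + 1 = roundTime k n m τ + 5 := rfl
  rw [h5] at ht
  refine ⟨t, ⟨σ, hrun, ρ, hρ, fun π' => ?_⟩, by omega⟩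
  -- The map behind an optimal dictatorship is the digit sequence of some `N < k ^ k`, so it was
  -- among the candidates.
  obtain ⟨f, hf, hopt⟩ := I.exists_dictator_isOptimal hI
  obtain ⟨N, hN, hdig⟩ := exists_digits_eq f hf
  have hcand : cand N = fun s => I.dictator f (f s) := by
    funext s
    simp only [cand, hdig]
  rw [← hw]
  exact (hle N hN).2.trans (hcand ▸ hopt π')

/-- Here `n` may be `0`, so no dictatorship need exist; but the empty plan is the only plan. -/
theorem solver_spec_zero {n m τ : ℕ} (I : ValuedInstance 0 n m) : SolvesInTime solver I τ 5 := by
  refine ⟨_, .condTrue (by simp [Test.Holds, Expr.eval, initialMemory]) (.skip _), Fin.elim0,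
    fun s => s.elim0, fun π' => ?_⟩
  rw [Subsingleton.elim π' Fin.elim0]

/-! ### Polynomial bounds on the running time -/

theorem roundTime_le (k n m τ : ℕ) :
    roundTime k n m τ ≤ 300 * ((k + n + m + 1) ^ 3 * (τ + 1)) := by
  have hk : k ≤ k + n + m + 1 := by omega
  have hn : n ≤ k + n + m + 1 := by omega
  have hm : m ≤ k + n + m + 1 := by omega
  have h1 : 1 ≤ k + n + m + 1 := by omega
  have ht : τ ≤ τ + 1 := by omega
  have hM : 1 ≤ τ + 1 := by omega
  unfold roundTime
  generalize k + n + m + 1 = K at *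
  generalize τ + 1 = M at *
  -- Every term is padded to a multiple of `K ^ 3 * M`; the coefficients add up to 284.
  calc _ ≤ K * (K * K * M * 12) + K * (K * (K * M * 35) + K * (K * M + K * M + K * M * 40) +
        K * K * M * 37) + K * K * K * M * 14 +
        (K * (K * K * M + K * K * M + K * K * M * 15) +
          K * (K * K * M * 19 + K * K * M + K * K * M * 22) + K * K * K * M * 16 +
          (K * K * K * M * 13 + K * K * K * M * 19 + (K * K * K * M * 28 + K * K * K * M * 9))) := by
        have a1 : 1 ≤ K * M := Nat.mul_pos h1 hM
        have a2 : 1 ≤ K * K := Nat.mul_pos h1 h1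
        have a3 : 1 ≤ K * K * M := Nat.mul_pos a2 hM
        have a4 : 1 ≤ K * K * K * M := Nat.mul_pos (Nat.mul_pos a2 h1) hM
        have b1 : K ≤ K * M := Nat.le_mul_of_pos_right _ hM
        have b2 : M ≤ K * M := Nat.le_mul_of_pos_left _ h1
        have b3 : K * M ≤ K * K * M := Nat.mul_le_mul (Nat.le_mul_of_pos_left _ h1) le_rfl
        have b4 : K * K * M ≤ K * K * K * M :=
          Nat.mul_le_mul (Nat.le_mul_of_pos_right _ h1) le_rfl
        gcongr <;> omega
    _ ≤ _ := by ring_nf; omega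

/-- A single bound on the running time of the solver, in the number of steps and the size. -/
theorem solver_time (I : ValuedInstance k n m) (hI : I.UserIndependent)
    (hπ : Nonempty (Plan k n)) {b d : ℕ} (hτ : τ ≤ b * (k + n + m + 1) ^ d) :
    ∃ t, SolvesInTime solver I τ t ∧
      t ≤ 315 * (b + 1) * k ^ k * (k + n + m + 1) ^ (d + 3) := by
  have hK : ∀ e, 1 ≤ (k + n + m + 1) ^ e := fun e => Nat.one_le_pow _ _ (by omega)
  rcases Nat.eq_zero_or_pos k with rfl | hk
  · refine ⟨5, solver_spec_zero I, ?_⟩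
    calc 5 ≤ 315 * 1 * 1 * 1 := by norm_num
      _ ≤ _ := by gcongr <;> first | exact hK _ | simp
  · have : NeZero n := by
      obtain ⟨π⟩ := hπ
      exact ⟨fun h => (h ▸ π ⟨0, hk⟩).elim0⟩
    obtain ⟨t, ht, hle⟩ := solver_spec (τ := τ) hI hk
    refine ⟨t, ht, hle.trans ?_⟩
    rw [show 315 * (b + 1) * k ^ k * (k + n + m + 1) ^ (d + 3) =
      315 * k ^ k * ((b + 1) * (k + n + m + 1) ^ (d + 3)) by ring]
    have hpow : 1 ≤ k ^ k := Nat.one_le_pow _ _ hk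
    have h₁ : (k + n + m + 1) ^ 3 * (τ + 1) ≤ (b + 1) * (k + n + m + 1) ^ (d + 3) := by
      calc (k + n + m + 1) ^ 3 * (τ + 1)
          ≤ (k + n + m + 1) ^ 3 * (b * (k + n + m + 1) ^ d + (k + n + m + 1) ^ d) := by
            gcongr
            exact hK d
        _ = _ := by ring
    have h₂ : 1 ≤ (b + 1) * (k + n + m + 1) ^ (d + 3) := Nat.mul_pos (by omega) (hK _)
    have h₃ := roundTime_le k n m τ
    generalize (b + 1) * (k + n + m + 1) ^ (d + 3) = X at h₁ h₂ ⊢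
    -- The constant 315 is 300 for the round, 5 for the loop test and 10 for the additive overhead.
    calc k ^ k * (roundTime k n m τ + 5) + 10 ≤ k ^ k * (300 * X + 5 * X) + 10 * (k ^ k * X) := by
          gcongr
          · exact h₃.trans (by omega)
          · omega
          · have := Nat.mul_le_mul hpow h₂
            omega
      _ = _ := by ring

end

theorem computable_mul_self_pow (a : ℕ) : Computable fun k : ℕ => a * k ^ k := by
  have hpow : Primrec₂ fun k e : ℕ => k ^ e :=
    (Primrec.nat_rec (f := fun _ : ℕ => 1) (g := fun (k : ℕ) (p : ℕ × ℕ) => p.2 * k)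
      (Primrec.const 1) (Primrec.nat_mul.comp (Primrec.snd.comp Primrec.snd) Primrec.fst)).of_eq
      fun k e => by induction e with
        | zero => rfl
        | succ e ih => rw [pow_succ, ← ih]
  exact (Primrec.nat_mul.comp (Primrec.const a) (hpow.comp Primrec.id Primrec.id)).to_comp

/-- For `k = 0` both sides are `1`. -/
theorem two_rpow_mul_logb (k : ℕ) : (2 : ℝ) ^ ((k : ℝ) * Real.logb 2 k) = (k : ℝ) ^ k := by
  rcases Nat.eq_zero_or_pos k with rfl | hk
  · simp
  · rw [mul_comm, Real.rpow_mul (by norm_num), Real.rpow_logb (by norm_num) (by norm_num)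
      (by exact_mod_cast hk), Real.rpow_natCast]

end ValuedWSP

theorem theorem1 :
    (∃ P : ValuedWSP.Program, ∀ b d : ℕ, ∃ a c : ℕ,
      ∀ (k n m : ℕ) (I : ValuedWSP.ValuedInstance k n m), I.UserIndependent →
        Nonempty (ValuedWSP.Plan k n) →
          ∀ τ : ℕ, τ ≤ b * (k + n + m + 1) ^ d →
            ∃ t : ℕ, ValuedWSP.SolvesInTime P I τ t ∧
              (t : ℝ) ≤ a * (2 : ℝ) ^ ((k : ℝ) * Real.logb 2 k) * ((k : ℝ) + n + m + 1) ^ c) ∧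
    ValuedWSP.IsFPT (fun _ _ _ => {I | I.UserIndependent}) := by
  refine ⟨⟨ValuedWSP.solver, fun b d => ⟨315 * (b + 1), d + 3, fun k n m I hI hπ τ hτ => ?_⟩⟩,
    ⟨ValuedWSP.solver, fun b d => ⟨fun k => 315 * (b + 1) * k ^ k, d + 3,
      ValuedWSP.computable_mul_self_pow _, fun k n m I hI hπ τ hτ =>
        ValuedWSP.solver_time I hI hπ hτ⟩⟩⟩
  obtain ⟨t, ht, hle⟩ := ValuedWSP.solver_time I hI hπ hτ
  refine ⟨t, ht, ?_⟩
  rw [ValuedWSP.two_rpow_mul_logb]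
  exact_mod_cast hle
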